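/- **Lemma 1 (Hierarchical Covering Lemma).** Let $K\ge 1$, $\mathcal K=\{1,\dots,K\}$, and let $\mathbb A$ be the set of nonempty subsets of $\mathcal K$; write $\mathbb A^{l}=\{S\in\mathbb A:|S|=l\}$, $\mathbb A^{(l+1):K}=\{S\in\mathbb A:|S|>l\}$, and $\mathbb A(S)\setminus S=\{T\in\mathbb A: T\supsetneq S\}$. Let $U(\mathbb A)=(U_S)_{S\in\mathbb A}$ be random variables with finite alphabets and joint pmf $p$; for $\mathcal J\subseteq\mathbb A$ put $U(\mathcal J)=(U_S)_{S\in\mathcal J}$. Entropies are in bits. A sequence $x^n$ is $\epsilon$-typical for a pmf $q$, written $x^n\in\mathcal T^{(n)}_\epsilon$, if $|\pi(x\mid x^n)-q(x)|\le\epsilon\, q(x)$ for every symbol $x$, where $\pi(\cdot\mid x^n)$ is the empirical pmf of $x^n$; joint typicality of a tuple of sequences is typicality of the sequence of tuples. Then there is a function $\delta:(0,\infty)\to(0,\infty)$, depending only on $p$, with $\delta(\epsilon)\to0$ as $\epsilon\to0$, such that the following holds. Let $0<\epsilon_K<\epsilon_{K-1}<\dots<\epsilon_1$, let $r_S\in\mathbb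 R$ for $S\in\mathbb A$, $S\ne\mathcal K$, and for each $n$ let $U^n_{\mathcal K}$ be a random sequence with $\lim_{n\to\infty}P\{U^n_{\mathcal K}\in\mathcal T^{(n)}_{\epsilon_K}\}=1$. For each $n$ let random codewords $U_S^n(m_S)$, $m_S\in[1:2^{nr_S}]=\{1,\dots,2^{\lceil nr_S\rceil}\}$, $S\in\mathbb A$, $S\ne\mathcal K$, be given, generated level by level for $l=K-1,\dots,1$; the codeword $U_S^n(m_S)$ of a set with $|S|=l$ may, besides $m_S$, depend on the choice of the indices of the levels $l+1,\dots,K-1$ (there is such a codeword for each choice of these indices). Assume that for every $l\in[1:K-1]$ and every choice of the indices of the levels above $l$, conditionally on all codewords of the levels $l+1,\dots,K$: 1. each $U^n_S(m_S)$, $S\in\mathbb A^l$, has the law $\prod_{i=1}^n p_{U_S\mid U(\mathbb A(S)\setminus S)}\big(u_{S,i}\mid u_{T,i}:T\supsetneq S\big)$, where $u_T^n$ are the codewords with the chosen indices (nothing is required where this conditional pmf is undefined); 2. for each $S\in\mathbb A^l$ the codewords $U_S^n(m_S)$, $m_S\in[1:2^{nr_S}]$, are pairwise independent; 3. the families $\big(U_S^n(m_S):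 m_S\in[1:2^{nr_S}]\big)$, $S\in\mathbb A^l$, are mutually independent. If $$\sum_{S\in\mathcal J}r_S>\sum_{S\in\mathcal J}H\big(U_S\mid U(\mathbb A(S)\setminus S)\big)-H\big(U(\mathcal J)\mid U(\mathbb A^{(l+1):K})\big)+\delta(\epsilon_l)$$ for all $l\in[1:K-1]$ and all nonempty $\mathcal J\subseteq\mathbb A^l$, then $$\lim_{n\to\infty}P\Big\{\big((U_S^n(m_S))_{S\in\mathbb A,\,S\neq\mathcal K},\,U^n_{\mathcal K}\big)\notin\mathcal T^{(n)}_{\epsilon_1}\ \text{for all } (m_S)_S\in\prod_{S\in\mathbb A,\,S\ne\mathcal K}[1:2^{nr_S}]\Big\}=0 .$$ -/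

import Mathlib

open MeasureTheory ProbabilityTheory Filter Topology

noncomputable section

namespace HierCov

/-! ### Information measures of discrete random variables under a pmf -/

/-- The conditional probability `P(f = b | g = c)` under the pmf `p`
(only meaningful when `P(g = c) > 0`). -/
def condProb {γ β β' : Type*} (p : PMF γ) (f : γ → β) (g : γ → β') (b : β) (c : β') : ℝ :=
  (p.map (fun u => (f u, g u)) (b, c)).toReal / (p.map g c).toReal

/-- The conditional entropy `H(f | g)` in bits,
`- ∑_{b,c} P(f = b, g = c) log₂ P(f = b | g = c)`. -/
def condEntropy {γ β β' : Type*} [Fintype β] [Fintype β'] (p : PMF γ)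
    (f : γ → β) (g : γ → β') : ℝ :=
  -∑ b, ∑ c, (p.map (fun u => (f u, g u)) (b, c)).toReal * Real.logb 2 (condProb p f g b c)

open Classical in
/-- `x^n` is (robustly) `ε`-typical for the pmf `q`: its empirical pmf satisfies
`|π(b | x^n) - q(b)| ≤ ε q(b)` for every symbol `b`. -/
def Typical {β : Type*} (q : PMF β) (ε : ℝ) {n : ℕ} (x : Fin n → β) : Prop :=
  ∀ b, |((Finset.univ.filter fun i => x i = b).card : ℝ) / n - (q b).toReal|
    ≤ ε * (q b).toReal

/-! ### The index sets -/

/-- The nonempty subsets of `{1, …, K}`. -/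
abbrev Sets (K : ℕ) : Type := {S : Finset (Fin K) // S.Nonempty}

/-- The whole set `{1, …, K}`. -/
def whole (K : ℕ) [NeZero K] : Sets K := ⟨Finset.univ, Finset.univ_nonempty⟩

/-- The sets of cardinality `l`. -/
def level (K l : ℕ) : Finset (Sets K) := Finset.univ.filter fun S => S.1.card = l

/-- The sets of cardinality `l + 1, …, K`. -/
def upper (K l : ℕ) : Finset (Sets K) := Finset.univ.filter fun S => l < S.1.card

/-- The proper supersets of `S`. -/
def above {K : ℕ} (S : Sets K) : Finset (Sets K) := Finset.univ.filter fun T => S.1 ⊂ T.1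

/-! ### Random hierarchical codebooks -/

/-- The number of codewords of the set `S` at block length `n`: a single one for the whole set,
and `|[1 : 2^{n r_S}]| = 2^⌈n r_S⌉` for a proper subset. -/
def numWords {K : ℕ} (r : Sets K → ℝ) (n : ℕ) (S : Sets K) : ℕ :=
  if S.1 = Finset.univ then 1 else 2 ^ ⌈(n : ℝ) * r S⌉₊

/-- The index tuples `(m_S)_S`. -/
abbrev Index {K : ℕ} (r : Sets K → ℝ) (n : ℕ) : Type :=
  ∀ S : Sets K, Fin (numWords r n S)

/-- The event that all codewords of the levels above `l` take the same values as at `ω`.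
These events are the atoms on which one conditions when codewords of level `l` are generated. -/
def sameAbove {K : ℕ} {α : Sets K → Type*} {r : Sets K → ℝ} {n : ℕ} {Ω : Type*}
    (U : ∀ S : Sets K, Index r n → Ω → Fin n → α S) (l : ℕ) (ω : Ω) : Set Ω :=
  {ω' | ∀ T : Sets K, l < T.1.card → ∀ m, U T m ω' = U T m ω}

/-- `U S m` is the codeword `U_S^n(m_S)` that belongs to the choice `m` of indices. Besides `m_S`
it may depend on the indices of the codewords of higher levels given which it is generated
(as in superposition coding), but on no other index. -/
structure IsCodebook {K : ℕ} [NeZero K] {α : Sets K → Type*}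
    [∀ S, MeasurableSpace (α S)] (p : PMF (∀ S, α S)) (r : Sets K → ℝ) {n : ℕ}
    {Ω : Type*} [MeasurableSpace Ω] (μ : Measure Ω)
    (UK : Ω → Fin n → α (whole K))
    (U : ∀ S : Sets K, Index r n → Ω → Fin n → α S) : Prop where
  measurable : ∀ S m, Measurable (U S m)
  /-- The codeword of the whole set is the given random sequence. -/
  top : ∀ m, U (whole K) m = UK
  /-- The codeword of `S` is determined by the index of `S` and the indices of higher levels. -/
  index : ∀ S (m m' : Index r n), m S = m' S →
    (∀ T : Sets K, S.1.card < T.1.card → m T = m' T) → U S m = U S m'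
  /-- Given the codewords of higher levels, a codeword of `S` has the law
  `∏_i p(u_{S,i} | u_{S',i} : S' ⊋ S)`, wherever this conditional pmf is defined. -/
  law : ∀ S, S ≠ whole K → ∀ (m : Index r n) (ω : Ω), μ (sameAbove U S.1.card ω) ≠ 0 →
    (∀ i, p.map (above S).restrict (fun T => U T.1 m ω i) ≠ 0) →
    ∀ x : Fin n → α S,
      (μ[|sameAbove U S.1.card ω]).real {ω' | U S m ω' = x} =
        ∏ i, condProb p (fun u => u S) (above S).restrict (x i) (fun T => U T.1 m ω i)
  /-- Given the codewords of higher levels, the codewords of `S` are pairwise independent. -/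
  pairwise : ∀ S, S ≠ whole K → ∀ (m : Index r n) (ω : Ω), μ (sameAbove U S.1.card ω) ≠ 0 →
    ∀ a b : Fin (numWords r n S), a ≠ b →
      IndepFun (U S (Function.update m S a)) (U S (Function.update m S b))
        (μ[|sameAbove U S.1.card ω])
  /-- Given the codewords of higher levels, the families of codewords of the different sets of one
  level are mutually independent. -/
  mutual_indep : ∀ l, 1 ≤ l → l < K → ∀ (m : Index r n) (ω : Ω), μ (sameAbove U l ω) ≠ 0 →
    iIndepFun
      (fun (S : level K l) (ω' : Ω) (a : Fin (numWords r n S.1)) =>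
        U S.1 (Function.update m S.1 a) ω')
      (μ[|sameAbove U l ω])

end HierCov

end

/-!
The codewords are generated from the top level downwards, and so is the covering: `uncovered p U l
ε` is the event that no choice of indices makes the codewords of the levels above `l` jointly
`ε`-typical. If the levels above `l + 1` are covered, condition on their codewords and on a typical
choice of indices. The books of level `l + 1` are then independent, and Chebyshev's inequality
applies to the number of index tuples whose codewords are typical together with the chosen ones. In
the second moment, pairs of index tuples are grouped by the set `D` of books on which they agree.
Relative to the squared mean, the pairs with `D = ∅` contribute at most `1`, and those with `D`
nonempty at most about `2 ^ (-n e)` with `e = ∑_{S ∈ D} r_S - ∑_{S ∈ D} H(U_S | U(𝔸(S) \ S)) +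
H(U(D) | U(𝔸^{(l+2):K}))`, up to `O(ε)`. The rate condition for `𝒥 = D` makes `e` positive once
`δ(ε)` dominates this `O(ε)` term, so a linear `δ` suffices. The strict decrease of the `ε_l` enters
through the conditional typicality lemma, by which the mean of the number of typical tuples is
large.
-/

noncomputable section

namespace HierCov

section PMF

variable {γ β β₁ β' : Type*}

lemma toReal_pos_of_ne_zero (p : PMF γ) {u : γ} (h : p u ≠ 0) : 0 < (p u).toReal :=
  ENNReal.toReal_pos h (p.apply_ne_top u)

lemma map_apply_ne_zero (p : PMF γ) (f : γ → β) {u : γ} (h : p u ≠ 0) : p.map f (f u) ≠ 0 :=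
  (PMF.mem_support_map_iff f p _).2 ⟨u, h, rfl⟩

lemma condProb_pos (p : PMF γ) (f : γ → β) (g : γ → β') {u : γ} (h : p u ≠ 0) :
    0 < condProb p f g (f u) (g u) :=
  div_pos (toReal_pos_of_ne_zero _ (map_apply_ne_zero p (fun u => (f u, g u)) h))
    (toReal_pos_of_ne_zero _ (map_apply_ne_zero p g h))

lemma condProb_map (p : PMF β₁) (φ : β₁ → γ) (f : γ → β) (g : γ → β') (b : β) (c : β') :
    condProb (p.map φ) f g b c = condProb p (f ∘ φ) (g ∘ φ) b c := by
  simp only [condProb, PMF.map_comp, Function.comp_def]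

lemma condProb_comp_mul_condProb (p : PMF γ) (f : γ → β) (φ : β → β₁) (h : γ → β') {u : γ}
    (hu : p u ≠ 0) :
    condProb p (φ ∘ f) h (φ (f u)) (h u)
        * condProb p f (fun v => (φ (f v), h v)) (f u) (φ (f u), h u)
      = condProb p f h (f u) (h u) := by
  classical
  have hpair : p.map (fun v => (f v, φ (f v), h v)) (f u, φ (f u), h u)
      = p.map (fun v => (f v, h v)) (f u, h u) := by
    simp only [PMF.map_apply, Prod.mk.injEq]
    refine tsum_congr fun v => if_congr ?_ rfl rfl
    exact ⟨fun hv => ⟨hv.1, hv.2.2⟩, fun hv => ⟨hv.1, congrArg φ hv.1, hv.2⟩⟩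
  rw [condProb, condProb, condProb, hpair, mul_comm, Function.comp_def, div_mul_div_cancel₀]
  exact (toReal_pos_of_ne_zero _ (map_apply_ne_zero p (fun v => (φ (f v), h v)) hu)).ne'

section Discrete

variable [MeasurableSpace γ] [DiscreteMeasurableSpace γ]

lemma toReal_map_apply (p : PMF γ) (f : γ → β) (b : β) :
    (p.map f b).toReal = p.toMeasure.real (f ⁻¹' {b}) := by
  rw [measureReal_def, PMF.toMeasure_apply_eq_toOuterMeasure,
    ← PMF.toOuterMeasure_map_apply, PMF.toOuterMeasure_apply_singleton]

lemma condProb_eq_cond (p : PMF γ) (f : γ → β) (g : γ → β') (b : β) (c : β') :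
    condProb p f g b c = (p.toMeasure[|g ⁻¹' {c}]).real (f ⁻¹' {b}) := by
  have hpair : (fun u => (f u, g u)) ⁻¹' {(b, c)} = g ⁻¹' {c} ∩ f ⁻¹' {b} := by
    ext u
    simp [and_comm]
  rw [condProb, toReal_map_apply, toReal_map_apply, hpair, measureReal_def,
    measureReal_def, measureReal_def, cond_apply .of_discrete, ENNReal.toReal_mul,
    ENNReal.toReal_inv, div_eq_inv_mul]

lemma ae_apply_ne_zero (p : PMF γ) : ∀ᵐ u ∂p.toMeasure, p u ≠ 0 := by
  refine (PMF.toMeasure_apply_eq_zero_iff p .of_discrete).2 ?_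
  exact Set.disjoint_left.2 fun u hu hu' => hu' hu

lemma integral_map_toMeasure [MeasurableSpace β] [DiscreteMeasurableSpace β] (p : PMF γ)
    (f : γ → β) (g : β → ℝ) :
    ∫ b, g b ∂(p.map f).toMeasure = ∫ u, g (f u) ∂p.toMeasure := by
  rw [← PMF.toMeasure_map f p .of_discrete,
    integral_map Measurable.of_discrete.aemeasurable Measurable.of_discrete.aestronglyMeasurable]

lemma condEntropy_eq_integral [Fintype β] [Fintype β'] (p : PMF γ) (f : γ → β) (g : γ → β') :
    condEntropy p f g = -∫ u, Real.logb 2 (condProb p f g (f u) (g u)) ∂p.toMeasure := by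
  let _ : MeasurableSpace (β × β') := ⊤
  rw [← integral_map_toMeasure p (fun u => (f u, g u))
    fun x => Real.logb 2 (condProb p f g x.1 x.2), PMF.integral_eq_sum, Fintype.sum_prod_type]
  rfl

end Discrete

lemma condEntropy_map [Fintype β] [Fintype β'] (p : PMF β₁) (φ : β₁ → γ) (f : γ → β)
    (g : γ → β') : condEntropy (p.map φ) f g = condEntropy p (f ∘ φ) (g ∘ φ) := by
  let _ : MeasurableSpace β₁ := ⊤
  let _ : MeasurableSpace γ := ⊤
  simp only [condEntropy_eq_integral, integral_map_toMeasure, condProb_map, Function.comp_apply]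

lemma condEntropy_congr [Fintype β] [Fintype β₁] [Fintype β'] (p : PMF γ) {f : γ → β} {f₁ : γ → β₁}
    (g : γ → β') (h : ∀ u v, f v = f u ↔ f₁ v = f₁ u) :
    condEntropy p f g = condEntropy p f₁ g := by
  let _ : MeasurableSpace γ := ⊤
  simp only [condEntropy_eq_integral, condProb_eq_cond]
  congr! 6 with u
  ext v
  exact h u v

lemma condEntropy_chain_rule [Finite γ] [Fintype β] [Fintype β₁] [Fintype β'] (p : PMF γ)
    (f : γ → β) (φ : β → β₁) (h : γ → β') :
    condEntropy p f h
      = condEntropy p (φ ∘ f) h + condEntropy p f (fun u => (φ (f u), h u)) := by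
  let _ : MeasurableSpace γ := ⊤
  rw [condEntropy_eq_integral, condEntropy_eq_integral, condEntropy_eq_integral, ← neg_add,
    ← integral_add .of_finite .of_finite]
  refine congrArg Neg.neg (integral_congr_ae ?_)
  filter_upwards [ae_apply_ne_zero p] with u hu
  rw [← condProb_comp_mul_condProb p f φ h hu]
  exact Real.logb_mul (condProb_pos p (φ ∘ f) h hu).ne'
    (condProb_pos p f (fun u => (φ (f u), h u)) hu).ne'

end PMF

namespace Typical

variable {β β' : Type*} {q : PMF β} {ε : ℝ} {n : ℕ} {x : Fin n → β}

lemma apply_ne_zero (hx : Typical q ε x) (i : Fin n) : q (x i) ≠ 0 := by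
  intro h0
  have hcount := hx (x i)
  have hn : n ≠ 0 := i.pos.ne'
  simp only [h0, ENNReal.toReal_zero, sub_zero, mul_zero, abs_nonpos_iff, div_eq_zero_iff,
    Nat.cast_eq_zero, Finset.card_eq_zero, hn, or_false, Finset.filter_eq_empty_iff] at hcount
  exact hcount (Finset.mem_univ i) rfl

variable [Finite β]

lemma map (hx : Typical q ε x) (f : β → β') : Typical (q.map f) ε (f ∘ x) := by
  classical
  have := Fintype.ofFinite β
  let _ : MeasurableSpace β := ⊤
  intro c
  have hmass : (q.map f c).toReal = ∑ b with f b = c, (q b).toReal := by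
    simp_rw [toReal_map_apply, ← PMF.toMeasure_apply_singleton q _ .of_discrete,
      ← measureReal_def, sum_measureReal_singleton, Finset.coe_filter_univ, Set.preimage,
      Set.mem_singleton_iff]
  have hcount : ((Finset.univ.filter fun i => f (x i) = c).card : ℝ)
      = ∑ b with f b = c, ((Finset.univ.filter fun i => x i = b).card : ℝ) := by
    rw [← Nat.cast_sum, Finset.card_eq_sum_card_fiberwise (f := x) (t := {b | f b = c})
      fun i => by simp]
    refine congrArg Nat.cast (Finset.sum_congr rfl fun b hb => congrArg Finset.card ?_)
    ext i
    simp only [Finset.mem_filter, Finset.mem_univ, true_and] at hb ⊢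
    exact ⟨And.right, fun h => ⟨h ▸ hb, h⟩⟩
  simp only [Function.comp_apply, hcount, hmass, Finset.sum_div, ← Finset.sum_sub_distrib,
    Finset.mul_sum]
  exact (Finset.abs_sum_le_sum_abs _ _).trans (Finset.sum_le_sum fun b _ => hx b)

variable [MeasurableSpace β] [DiscreteMeasurableSpace β]

lemma abs_sum_sub_le (hx : Typical q ε x) (g : β → ℝ) :
    |∑ i, g (x i) - n * ∫ b, g b ∂q.toMeasure| ≤ n * (ε * ∫ b, |g b| ∂q.toMeasure) := by
  classical
  have := Fintype.ofFinite β
  have hsum : ∑ i, g (x i) = ∑ b, (Finset.univ.filter fun i => x i = b).card * g b := by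
    rw [← Finset.sum_fiberwise' Finset.univ x g]
    simp only [Finset.sum_const, nsmul_eq_mul]
  rcases n.eq_zero_or_pos with rfl | hn
  · simp
  rw [PMF.integral_eq_sum, PMF.integral_eq_sum, hsum]
  simp only [smul_eq_mul, Finset.mul_sum, ← Finset.sum_sub_distrib]
  refine (Finset.abs_sum_le_sum_abs _ _).trans (Finset.sum_le_sum fun b _ => ?_)
  set N : ℝ := ((Finset.univ.filter fun i => x i = b).card : ℝ)
  calc |N * g b - n * ((q b).toReal * g b)| = |n * ((N / n - (q b).toReal) * g b)| := by
        congr 1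
        field_simp
    _ = n * (|N / n - (q b).toReal| * |g b|) := by rw [abs_mul, abs_mul, Nat.abs_cast]
    _ ≤ n * (ε * (q b).toReal * |g b|) := by gcongr; exact hx b
    _ = n * (ε * ((q b).toReal * |g b|)) := by rw [mul_assoc]

lemma measurableSet_setOf {Ω : Type*} [MeasurableSpace Ω] {X : Ω → Fin n → β} (q : PMF β) (ε : ℝ)
    (hX : Measurable X) :
    MeasurableSet {ω | Typical q ε (X ω)} :=
  hX (Set.toFinite {x | Typical q ε x}).measurableSet

end Typical

lemma sum_real_fiber_mul_cond_real {Ω A : Type*} [MeasurableSpace Ω] [Fintype A] [MeasurableSpace A]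
    [DiscreteMeasurableSpace A] (μ : Measure Ω) [IsFiniteMeasure μ] {V : Ω → A} (hV : Measurable V)
    (s : Set Ω) :
    ∑ v, μ.real (V ⁻¹' {v}) * (μ[|V ⁻¹' {v}]).real s = μ.real s := by
  have h := congrArg (fun m => (m s).toReal) (sum_meas_smul_cond_fiber hV μ)
  simp only [Measure.coe_finsetSum, Measure.coe_smul, Finset.sum_apply, Pi.smul_apply,
    smul_eq_mul] at h
  rw [ENNReal.toReal_sum fun v _ => by finiteness] at h
  simpa only [ENNReal.toReal_mul, ← measureReal_def] using h

section CondSeqLaw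

variable {B C : Type*} [MeasurableSpace B] {n : ℕ}

/-- The law of a sequence of independent symbols, the `i`-th of which is drawn from the conditional
law of `q` given that `f` takes the value `c i`. -/
def condSeqLaw (q : PMF B) (f : B → C) (c : Fin n → C) : Measure (Fin n → B) :=
  Measure.pi fun i => q.toMeasure[|f ⁻¹' {c i}]

instance isFiniteMeasure_condSeqLaw (q : PMF B) (f : B → C) (c : Fin n → C) :
    IsFiniteMeasure (condSeqLaw q f c) :=
  inferInstanceAs (IsFiniteMeasure (Measure.pi fun i => q.toMeasure[|f ⁻¹' {c i}]))

variable [DiscreteMeasurableSpace B]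

lemma isProbabilityMeasure_cond_fiber (q : PMF B) (f : B → C) {c : C} (hc : q.map f c ≠ 0) :
    IsProbabilityMeasure q.toMeasure[|f ⁻¹' {c}] := by
  refine cond_isProbabilityMeasure fun h0 => (toReal_pos_of_ne_zero _ hc).ne' ?_
  rw [toReal_map_apply, measureReal_def, h0, ENNReal.toReal_zero]

lemma isProbabilityMeasure_condSeqLaw {q : PMF B} {f : B → C} {c : Fin n → C}
    (hc : ∀ i, q.map f (c i) ≠ 0) : IsProbabilityMeasure (condSeqLaw q f c) :=
  have (i : Fin n) := isProbabilityMeasure_cond_fiber q f (hc i)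
  Measure.pi.instIsProbabilityMeasure _

lemma condSeqLaw_real_singleton (q : PMF B) (f : B → C) (c : Fin n → C) (y : Fin n → B) :
    (condSeqLaw q f c).real {y} = ∏ i, condProb q id f (y i) (c i) := by
  simp only [condSeqLaw, measureReal_def, Measure.pi_singleton, ENNReal.toReal_prod,
    condProb_eq_cond, Set.preimage_id]

lemma ae_condSeqLaw (q : PMF B) (f : B → C) (c : Fin n → C) :
    ∀ᵐ y ∂condSeqLaw q f c, ∀ i, q (y i) ≠ 0 ∧ f (y i) = c i := by
  refine ae_all_iff.2 fun i => ?_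
  have h : ∀ᵐ b ∂q.toMeasure[|f ⁻¹' {c i}], q b ≠ 0 ∧ f b = c i := by
    filter_upwards [cond_absolutelyContinuous.ae_le (ae_apply_ne_zero q), ae_cond_mem .of_discrete]
      with b hb hbc using ⟨hb, hbc⟩
  exact (Measure.quasiMeasurePreserving_eval (fun i => q.toMeasure[|f ⁻¹' {c i}]) i).ae h

lemma integral_condProb [Finite C] [MeasurableSpace C] [DiscreteMeasurableSpace C]
    (q : PMF B) (f : B → C) (b : B) :
    ∫ c, condProb q id f b c ∂(q.map f).toMeasure = (q b).toReal := by
  have := Fintype.ofFinite C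
  rw [PMF.integral_eq_sum, ← PMF.toMeasure_apply_singleton q b .of_discrete, ← measureReal_def,
    ← sum_real_fiber_mul_cond_real q.toMeasure (V := f) .of_discrete {b}]
  simp only [toReal_map_apply, condProb_eq_cond, smul_eq_mul, Set.preimage_id]

open Classical in
lemma pi_real_le_abs_count_sub_le (P : Fin n → Measure B) [∀ i, IsProbabilityMeasure (P i)] (b : B)
    {t : ℝ} (ht : 0 < t) :
    (Measure.pi P).real {y | t ≤ |((Finset.univ.filter fun i => y i = b).card : ℝ)
      - ∑ i, (P i).real {b}|} ≤ n / t ^ 2 := by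
  set X : B → ℝ := Set.indicator {b} 1
  have hX : Measurable X := .of_discrete
  have hXbound : ∀ b', X b' ∈ Set.Icc (0 : ℝ) 1 := fun b' =>
    ⟨Set.indicator_nonneg (by simp) _, Set.indicator_le_self' (by simp) _⟩
  have hX2 : ∀ i, MemLp X 2 (P i) := fun i => memLp_of_bounded (.of_forall hXbound)
    hX.aestronglyMeasurable 2
  have hcount : ∀ y : Fin n → B, ((Finset.univ.filter fun i => y i = b).card : ℝ)
      = (∑ i, fun y : Fin n → B => X (y i)) y := fun y => by
    simp only [Finset.natCast_card_filter, Finset.sum_apply, X, Set.indicator_apply,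
      Set.mem_singleton_iff, Pi.one_apply]
  have hX2pi : ∀ i, MemLp (fun y : Fin n → B => X (y i)) 2 (Measure.pi P) := fun i =>
    (hX2 i).comp_measurePreserving (measurePreserving_eval P i)
  have hmean : ∫ y, (∑ i, fun y : Fin n → B => X (y i)) y ∂Measure.pi P = ∑ i, (P i).real {b} := by
    simp only [Finset.sum_apply]
    rw [integral_finsetSum _ fun i _ => (hX2pi i).integrable (by norm_num)]
    refine Finset.sum_congr rfl fun i _ => ?_
    rw [integral_comp_eval hX.aestronglyMeasurable, integral_indicator_one .of_discrete]
  have hvar : Var[∑ i, fun y : Fin n → B => X (y i); Measure.pi P] ≤ n := by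
    rw [variance_sum_pi hX2]
    refine (Finset.sum_le_card_nsmul _ _ 1 fun i _ => ?_).trans_eq (by simp)
    exact (variance_le_sq_of_bounded (.of_forall hXbound) hX.aemeasurable).trans (by norm_num)
  simp only [hcount, ← hmean]
  have hnonneg := variance_nonneg (∑ i, fun y : Fin n → B => X (y i)) (Measure.pi P)
  refine (ENNReal.toReal_le_of_le_ofReal (by positivity)
    (meas_ge_le_variance_div_sq (memLp_finsetSum' _ fun i _ => hX2pi i) ht)).trans ?_
  gcongr

lemma Typical.abs_sum_condProb_sub_le [Finite C] {q : PMF B} {f : B → C} {ε : ℝ} {c : Fin n → C}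
    (hc : Typical (q.map f) ε c) (b : B) :
    |∑ i, condProb q id f b (c i) - n * (q b).toReal| ≤ n * (ε * (q b).toReal) := by
  let _ : MeasurableSpace C := ⊤
  have h := hc.abs_sum_sub_le (condProb q id f b)
  simp only [condProb_eq_cond, abs_of_nonneg measureReal_nonneg] at h
  simpa only [← condProb_eq_cond, integral_condProb] using h

open Classical in
lemma Typical.condSeqLaw_real_atypical_le [Finite C] {q : PMF B} {f : B → C} {ε ε' : ℝ}
    (hε : ε' < ε) (hn : 0 < n) {c : Fin n → C} (hc : Typical (q.map f) ε' c) (b : B) :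
    (condSeqLaw q f c).real {y | ¬ |((Finset.univ.filter fun i => y i = b).card : ℝ) / n
      - (q b).toReal| ≤ ε * (q b).toReal} ≤ 1 / ((ε - ε') * (q b).toReal) ^ 2 / n := by
  have := isProbabilityMeasure_condSeqLaw hc.apply_ne_zero
  by_cases hb : q b = 0
  · refine ((measureReal_eq_zero_iff (measure_ne_top _ _)).2
      (measure_eq_zero_iff_ae_notMem.2 ?_)).trans_le (by positivity)
    filter_upwards [ae_condSeqLaw q f c] with y hy
    have hcount : (Finset.univ.filter fun i => y i = b) = ∅ :=
      Finset.filter_eq_empty_iff.2 fun i _ hi => (hy i).1 (hi ▸ hb)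
    simp [hcount, hb]
  have hn' : (0 : ℝ) < n := Nat.cast_pos.2 hn
  have ht : 0 < n * ((ε - ε') * (q b).toReal) :=
    mul_pos hn' (mul_pos (sub_pos.2 hε) (toReal_pos_of_ne_zero q hb))
  have (i : Fin n) := isProbabilityMeasure_cond_fiber q f (hc.apply_ne_zero i)
  have hmean := hc.abs_sum_condProb_sub_le b
  simp only [condProb_eq_cond, Set.preimage_id] at hmean
  refine (measureReal_mono (fun y hy => ?_) (measure_ne_top (condSeqLaw q f c) _)).trans
    ((pi_real_le_abs_count_sub_le _ b ht).trans_eq (by field_simp))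
  rw [Set.mem_ofPred_eq, not_le, div_sub' hn'.ne', abs_div, Nat.abs_cast, lt_div_iff₀ hn'] at hy
  have htriangle := abs_sub_le ((Finset.univ.filter fun i => y i = b).card : ℝ)
    (∑ i, (q.toMeasure[|f ⁻¹' {c i}]).real {b}) (n * (q b).toReal)
  rw [Set.mem_ofPred_eq]
  linarith

lemma eventually_half_le_condSeqLaw_typical [Finite B] [Finite C] (q : PMF B) (f : B → C)
    {ε ε' : ℝ} (hε : ε' < ε) :
    ∀ᶠ n : ℕ in atTop, ∀ c : Fin n → C, Typical (q.map f) ε' c →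
      1 / 2 ≤ (condSeqLaw q f c).real {y | Typical q ε y} := by
  classical
  have := Fintype.ofFinite B
  set A : ℝ := ∑ b, 1 / ((ε - ε') * (q b).toReal) ^ 2
  filter_upwards [(tendsto_const_div_atTop_nhds_zero_nat A).eventually_le_const
    (show (0 : ℝ) < 1 / 2 by norm_num), eventually_gt_atTop 0] with n hA hn c hc
  have := isProbabilityMeasure_condSeqLaw hc.apply_ne_zero
  have hbad : (condSeqLaw q f c).real {y | Typical q ε y}ᶜ ≤ A / n := by
    have hunion : {y : Fin n → B | Typical q ε y}ᶜ = ⋃ b,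
        {y | ¬ |((Finset.univ.filter fun i => y i = b).card : ℝ) / n - (q b).toReal|
          ≤ ε * (q b).toReal} := by
      ext y
      simp only [Typical, Set.mem_compl_iff, Set.mem_ofPred_eq, not_forall, Set.mem_iUnion]
    rw [hunion, Finset.sum_div]
    exact (measureReal_iUnion_fintype_le _).trans
      (Finset.sum_le_sum fun b _ => hc.condSeqLaw_real_atypical_le hε hn b)
  rw [probReal_compl_eq_one_sub .of_discrete] at hbad
  linarith

end CondSeqLaw

/-- The second moment method: Chebyshev's inequality for the number of events that occur. -/
lemma sq_mul_measureReal_forall_notMem_le {Ω κ : Type*} [MeasurableSpace Ω] [Fintype κ]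
    (ν : Measure Ω) [IsProbabilityMeasure ν] {A : κ → Set Ω} (hA : ∀ a, MeasurableSet (A a)) :
    (∑ a, ν.real (A a)) ^ 2 * ν.real {ω | ∀ a, ω ∉ A a}
      ≤ (∑ a, ∑ b, ν.real (A a ∩ A b)) - (∑ a, ν.real (A a)) ^ 2 := by
  set Z : Ω → ℝ := ∑ a, (A a).indicator 1
  have hind : ∀ s : Set Ω, MeasurableSet s → MemLp (s.indicator (1 : Ω → ℝ)) 2 ν := fun s hs =>
    (memLp_const (1 : ℝ)).indicator hs
  have hZ : MemLp Z 2 ν := memLp_finsetSum' _ fun a _ => hind _ (hA a)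
  have hmean : ∫ ω, Z ω ∂ν = ∑ a, ν.real (A a) := by
    simp only [Z, Finset.sum_apply]
    rw [integral_finsetSum _ fun a _ => (hind _ (hA a)).integrable one_le_two]
    exact Finset.sum_congr rfl fun a _ => integral_indicator_one (hA a)
  have hsq : ∫ ω, (Z ^ 2) ω ∂ν = ∑ a, ∑ b, ν.real (A a ∩ A b) := by
    have hint : ∀ a b, Integrable ((A a ∩ A b).indicator (1 : Ω → ℝ)) ν := fun a b =>
      (hind _ ((hA a).inter (hA b))).integrable one_le_two
    simp only [Z, sq, Finset.sum_mul_sum, ← Set.inter_indicator_one, Finset.sum_apply]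
    rw [integral_finsetSum _ fun a _ => integrable_finsetSum _ fun b _ => hint a b]
    refine Finset.sum_congr rfl fun a _ => ?_
    rw [integral_finsetSum _ fun b _ => hint a b]
    exact Finset.sum_congr rfl fun b _ => integral_indicator_one ((hA a).inter (hA b))
  have hvar := variance_eq_sub hZ
  rw [hmean, hsq] at hvar
  rw [← hvar]
  set m := ∑ a, ν.real (A a)
  have hm : 0 ≤ m := Finset.sum_nonneg fun a _ => measureReal_nonneg
  rcases hm.eq_or_lt with hm | hm
  · simp [← hm, variance_nonneg]
  rw [← le_div_iff₀' (by positivity)]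
  have hcheb := ENNReal.toReal_le_of_le_ofReal (div_nonneg (variance_nonneg Z ν) (sq_nonneg m))
    (meas_ge_le_variance_div_sq hZ hm)
  refine (measureReal_mono fun ω hω => ?_).trans hcheb
  have hZω : Z ω = 0 := by
    simp only [Z, Finset.sum_apply]
    exact Finset.sum_eq_zero fun a _ => Set.indicator_of_notMem (hω a) _
  simp [hZω, hmean, abs_of_pos hm]

section RandomCode

variable {Ω ι : Type*} [MeasurableSpace Ω] {κ E : ι → Type*} [∀ s, MeasurableSpace (E s)]

/-- A random code with one book `X s` for each `s`: the codewords of a book are pairwise independent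
with point masses `w s`, and the books are independent. -/
structure IsRandomCode (X : ∀ s, κ s → Ω → E s) (w : ∀ s, E s → ℝ) (ν : Measure Ω) : Prop where
  measurable : ∀ s a, Measurable (X s a)
  law : ∀ s a x, ν.real (X s a ⁻¹' {x}) = w s x
  pairwise : ∀ s a b, a ≠ b → IndepFun (X s a) (X s b) ν
  iIndep : iIndepFun (fun s ω a => X s a ω) ν

/-- The tuple of codewords with indices `a`, one from each book of a code. -/
def word (X : ∀ s, κ s → Ω → E s) (a : ∀ s, κ s) (ω : Ω) (s : ι) : E s := X s (a s) ω

open Classical in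
/-- The set of books for which the index tuples `a` and `b` select the same codeword. -/
def agree [Fintype ι] (a b : ∀ s, κ s) : Finset ι := {s | a s = b s}

lemma mem_agree [Fintype ι] {a b : ∀ s, κ s} {s : ι} : s ∈ agree a b ↔ a s = b s := by
  simp [agree]

lemma card_agree_superset_mul [Fintype ι] [DecidableEq ι] [∀ s, Fintype (κ s)] (a : ∀ s, κ s)
    (D : Finset ι) :
    (Finset.univ.filter fun b => D ⊆ agree a b).card * ∏ s ∈ D, Fintype.card (κ s)
      = ∏ s, Fintype.card (κ s) := by
  have hpi : (Finset.univ.filter fun b => D ⊆ agree a b)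
      = Fintype.piFinset fun s => if s ∈ D then {a s} else Finset.univ := by
    ext b
    simp only [Finset.mem_filter, Finset.mem_univ, true_and, Fintype.mem_piFinset,
      Finset.subset_iff, mem_agree]
    refine forall_congr' fun s => ?_
    by_cases hs : s ∈ D <;> simp [hs, eq_comm]
  rw [hpi, Fintype.card_piFinset, ← Finset.prod_ite_mem_eq D, ← Finset.prod_mul_distrib]
  refine Finset.prod_congr rfl fun s _ => ?_
  by_cases hs : s ∈ D <;> simp [hs]

lemma sum_agree_le [Fintype ι] [DecidableEq ι] [∀ s, Fintype (κ s)] [∀ s, Nonempty (κ s)]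
    (a : ∀ s, κ s) {R : Finset ι → ℝ} (hR : ∀ D, 0 ≤ R D) :
    ∑ b, R (agree a b)
      ≤ Fintype.card (∀ s, κ s) * ∑ D, R D / ∏ s ∈ D, (Fintype.card (κ s) : ℝ) := by
  rw [← Finset.sum_fiberwise Finset.univ (agree a), Finset.mul_sum]
  refine Finset.sum_le_sum fun D _ => ?_
  have hcard : ((Finset.univ.filter fun b => D ⊆ agree a b).card : ℝ)
      * ∏ s ∈ D, (Fintype.card (κ s) : ℝ) = Fintype.card (∀ s, κ s) := by
    rw [Fintype.card_pi, ← card_agree_superset_mul a D]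
    push_cast
    rfl
  calc ∑ b with agree a b = D, R (agree a b)
      = (Finset.univ.filter fun b => agree a b = D).card * R D := by
        rw [Finset.sum_congr rfl fun b hb => congrArg R (Finset.mem_filter.1 hb).2,
          Finset.sum_const, nsmul_eq_mul]
    _ ≤ (Finset.univ.filter fun b => D ⊆ agree a b).card * R D := by
        refine mul_le_mul_of_nonneg_right ?_ (hR D)
        exact_mod_cast Finset.card_le_card
          (Finset.monotone_filter_right _ fun b _ (hb : agree a b = D) => hb.symm.subset)
    _ = _ := by
        rw [← hcard]
        field_simp

namespace IsRandomCode

variable {X : ∀ s, κ s → Ω → E s} {w : ∀ s, E s → ℝ} {ν : Measure Ω}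

lemma nonneg [∀ s, Nonempty (κ s)] (hX : IsRandomCode X w ν) (s : ι) (x : E s) : 0 ≤ w s x :=
  hX.law s (Classical.arbitrary _) x ▸ measureReal_nonneg

lemma measurable_word (hX : IsRandomCode X w ν) (a : ∀ s, κ s) : Measurable (word X a) :=
  measurable_pi_lambda _ fun s => hX.measurable s (a s)

variable [∀ s, MeasurableSingletonClass (E s)]

open Classical in
lemma measureReal_codeword_pair (hX : IsRandomCode X w ν) (s : ι) (a b : κ s) (x y : E s) :
    ν.real (X s a ⁻¹' {x} ∩ X s b ⁻¹' {y})
      = w s x * if a = b then if y = x then 1 else 0 else w s y := by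
  split_ifs with hab hxy
  · rw [hab, hxy, Set.inter_self, mul_one, hX.law]
  · rw [hab, mul_zero, Disjoint.inter_eq (Disjoint.preimage _ (by simpa using Ne.symm hxy)),
      measureReal_empty]
  · rw [measureReal_def, (hX.pairwise s a b hab).measure_inter_preimage_eq_mul _ _
      (measurableSet_singleton x) (measurableSet_singleton y), ENNReal.toReal_mul,
      ← measureReal_def, ← measureReal_def, hX.law, hX.law]

variable [Fintype ι]

open Classical in
lemma measureReal_word_pair [DecidableEq ι] (hX : IsRandomCode X w ν) (a b : ∀ s, κ s)
    (x y : ∀ s, E s) :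
    ν.real (word X a ⁻¹' {x} ∩ word X b ⁻¹' {y}) = (∏ s, w s (x s)) *
      if ∀ s ∈ agree a b, y s = x s then ∏ s ∈ (agree a b)ᶜ, w s (y s) else 0 := by
  have hinter : word X a ⁻¹' {x} ∩ word X b ⁻¹' {y} = ⋂ s ∈ Finset.univ,
      (fun ω a => X s a ω) ⁻¹' {z : κ s → E s | z (a s) = x s ∧ z (b s) = y s} := by
    ext ω
    simp [word, funext_iff, forall_and]
  have hmeas : ∀ s, MeasurableSet {z : κ s → E s | z (a s) = x s ∧ z (b s) = y s} := fun s =>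
    have ha : MeasurableSet ((fun z : κ s → E s => z (a s)) ⁻¹' {x s}) :=
      measurable_pi_apply (a s) (measurableSet_singleton (x s))
    have hb : MeasurableSet ((fun z : κ s → E s => z (b s)) ⁻¹' {y s}) :=
      measurable_pi_apply (b s) (measurableSet_singleton (y s))
    ha.inter hb
  have hfactor : ∀ s, ν.real ((fun ω a => X s a ω) ⁻¹' {z | z (a s) = x s ∧ z (b s) = y s})
      = w s (x s) * if a s = b s then if y s = x s then 1 else 0 else w s (y s) := fun s =>
    hX.measureReal_codeword_pair s (a s) (b s) (x s) (y s)
  rw [measureReal_def, hinter, hX.iIndep.measure_inter_preimage_eq_mul _ fun s _ => hmeas s,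
    ENNReal.toReal_prod]
  simp only [← measureReal_def, hfactor, Finset.prod_mul_distrib]
  rw [← Finset.prod_mul_prod_compl (agree a b) fun s => ite (a s = b s) _ _,
    Finset.prod_congr rfl fun s hs => if_pos (mem_agree.1 hs), Finset.prod_boole,
    Finset.prod_congr rfl fun s hs => if_neg fun h => Finset.mem_compl.1 hs (mem_agree.2 h),
    ite_mul, one_mul, zero_mul]
  congr

open Classical in
lemma measureReal_hit_pair [DecidableEq ι] [∀ s, Finite (E s)] [IsFiniteMeasure ν]
    (hX : IsRandomCode X w ν) (T : Finset (∀ s, E s)) (a b : ∀ s, κ s) :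
    ν.real (word X a ⁻¹' T ∩ word X b ⁻¹' T) = ∑ x ∈ T, (∏ s, w s (x s)) *
      ∑ y ∈ T with ∀ s ∈ agree a b, y s = x s, ∏ s ∈ (agree a b)ᶜ, w s (y s) := by
  have hpreimage : word X a ⁻¹' T ∩ word X b ⁻¹' T
      = (fun ω => (word X a ω, word X b ω)) ⁻¹' (T ×ˢ T : Finset _) := by
    ext ω
    simp
  rw [hpreimage, ← sum_measureReal_preimage_singleton _ fun z _ =>
    ((hX.measurable_word a).prodMk (hX.measurable_word b)) (measurableSet_singleton z),
    Finset.sum_product]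
  refine Finset.sum_congr rfl fun x _ => ?_
  rw [Finset.sum_filter, Finset.mul_sum]
  refine Finset.sum_congr rfl fun y _ => ?_
  rw [← hX.measureReal_word_pair]
  congr 1
  ext ω
  simp

lemma measureReal_hit [∀ s, Finite (E s)] [IsFiniteMeasure ν] (hX : IsRandomCode X w ν)
    (T : Finset (∀ s, E s)) (a : ∀ s, κ s) :
    ν.real (word X a ⁻¹' T) = ∑ x ∈ T, ∏ s, w s (x s) := by
  classical
  have hagree : agree a a = Finset.univ := by
    ext s
    simp [mem_agree]
  rw [← Set.inter_self (word X a ⁻¹' T), hX.measureReal_hit_pair]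
  refine Finset.sum_congr rfl fun x hx => ?_
  have hfilter : {y ∈ T | ∀ s ∈ agree a a, y s = x s} = {x} := by
    ext y
    simp only [hagree, Finset.mem_filter, Finset.mem_univ, true_imp_iff, Finset.mem_singleton]
    exact ⟨fun h => funext h.2, fun h => ⟨h ▸ hx, congrFun h⟩⟩
  rw [hfilter, Finset.sum_singleton, hagree, Finset.compl_univ, Finset.prod_empty, mul_one]

open Classical in
-- The term `D = ∅` is the contribution of the pairs with independent words, hence the `+ 1`.
lemma measureReal_forall_notMem_add_one_le [DecidableEq ι] [∀ s, Finite (E s)]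
    [∀ s, Fintype (κ s)] [∀ s, Nonempty (κ s)] [IsProbabilityMeasure ν]
    (hX : IsRandomCode X w ν) (T : Finset (∀ s, E s))
    (hQ : 0 < ∑ x ∈ T, ∏ s, w s (x s)) (R : Finset ι → ℝ)
    (hR : ∀ D, ∀ x ∈ T, ∑ y ∈ T with ∀ s ∈ D, y s = x s, ∏ s ∈ Dᶜ, w s (y s) ≤ R D) :
    ν.real {ω | ∀ a, word X a ω ∉ T} + 1
      ≤ ∑ D, R D / ((∑ x ∈ T, ∏ s, w s (x s)) * ∏ s ∈ D, (Fintype.card (κ s) : ℝ)) := by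
  set Q := ∑ x ∈ T, ∏ s, w s (x s)
  set M : ℝ := (Fintype.card (∀ s, κ s) : ℝ)
  have hM : 0 < M := Nat.cast_pos.2 Fintype.card_pos
  have hsum : ∑ a, ν.real (word X a ⁻¹' T) = M * Q := by
    simp only [hX.measureReal_hit, Finset.sum_const, nsmul_eq_mul, Finset.card_univ, M, Q]
  have hpairs : ∀ a, ∑ b, ν.real (word X a ⁻¹' T ∩ word X b ⁻¹' T)
      ≤ M * ∑ D, Q * R D / ∏ s ∈ D, (Fintype.card (κ s) : ℝ) := fun a => by
    refine le_trans (Finset.sum_le_sum fun b _ => ?_) (sum_agree_le a fun D => ?_)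
    · rw [hX.measureReal_hit_pair, Finset.sum_mul]
      exact Finset.sum_le_sum fun x hx => mul_le_mul_of_nonneg_left (hR _ x hx)
        (Finset.prod_nonneg fun s _ => hX.nonneg s _)
    · obtain ⟨x, hx, -⟩ := Finset.exists_ne_zero_of_sum_ne_zero hQ.ne'
      exact mul_nonneg hQ.le ((Finset.sum_nonneg fun y _ => Finset.prod_nonneg fun s _ =>
        hX.nonneg s _).trans (hR D x hx))
  have hsecond := sq_mul_measureReal_forall_notMem_le ν
    fun a => hX.measurable_word a T.measurableSet
  rw [hsum] at hsecond
  have htotal := (Finset.sum_le_sum fun a _ => hpairs a).trans_eq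
    (Finset.sum_const (s := (Finset.univ : Finset (∀ s, κ s))) _)
  rw [nsmul_eq_mul, Finset.card_univ] at htotal
  have hscale : (M * Q) ^ 2 * ∑ D, R D / (Q * ∏ s ∈ D, (Fintype.card (κ s) : ℝ))
      = M * (M * ∑ D, Q * R D / ∏ s ∈ D, (Fintype.card (κ s) : ℝ)) := by
    simp only [Finset.mul_sum]
    refine Finset.sum_congr rfl fun D _ => ?_
    field_simp
  refine le_of_mul_le_mul_left ?_ (sq_pos_of_pos (mul_pos hM hQ))
  simp only [Set.mem_preimage, Finset.mem_coe] at hsecond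
  linarith

open Classical in
lemma measureReal_forall_notMem_le [DecidableEq ι] [∀ s, Finite (E s)]
    [∀ s, Fintype (κ s)] [∀ s, Nonempty (κ s)] [IsProbabilityMeasure ν]
    (hX : IsRandomCode X w ν) (T : Finset (∀ s, E s))
    (hQ : 0 < ∑ x ∈ T, ∏ s, w s (x s)) (R : Finset ι → ℝ)
    (hR : ∀ D, D.Nonempty → ∀ x ∈ T,
      ∑ y ∈ T with ∀ s ∈ D, y s = x s, ∏ s ∈ Dᶜ, w s (y s) ≤ R D) :
    ν.real {ω | ∀ a, word X a ω ∉ T} ≤ ∑ D with D.Nonempty,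
      R D / ((∑ x ∈ T, ∏ s, w s (x s)) * ∏ s ∈ D, (Fintype.card (κ s) : ℝ)) := by
  have h := hX.measureReal_forall_notMem_add_one_le T hQ
    (Function.update R ∅ (∑ x ∈ T, ∏ s, w s (x s))) fun D x hx => ?_
  · rw [← Finset.sum_filter_add_sum_filter_not _ Finset.Nonempty] at h
    simp only [Finset.not_nonempty_iff_eq_empty, Finset.filter_eq', Finset.mem_univ, if_true,
      Finset.sum_singleton, Function.update_self, Finset.prod_empty, mul_one, div_self hQ.ne',
      add_le_add_iff_right] at h
    refine h.trans_eq (Finset.sum_congr rfl fun D hD => ?_)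
    rw [Function.update_of_ne (Finset.mem_filter.1 hD).2.ne_empty]
  · rcases D.eq_empty_or_nonempty with rfl | hD
    · simp
    · rw [Function.update_of_ne hD.ne_empty]
      exact hR D hD x hx

end IsRandomCode

end RandomCode

section LogRatio

variable {B C : Type*} {n : ℕ}

/-- The logarithm, in bits, of the ratio of the weights `w` to the conditional pmf of `q` given
`f`. -/
def logRatio (q : PMF B) (f : B → C) (w : B → ℝ) (b : B) : ℝ :=
  Real.logb 2 (w b / condProb q id f b (f b))

variable [MeasurableSpace B] [DiscreteMeasurableSpace B] {q : PMF B} {w : B → ℝ}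

lemma prod_weight_eq (f : B → C) (hw : ∀ b, q b ≠ 0 → 0 < w b) {y : Fin n → B}
    (hy : ∀ i, q (y i) ≠ 0) :
    ∏ i, w (y i) = (condSeqLaw q f (f ∘ y)).real {y} * 2 ^ ∑ i, logRatio q f w (y i) := by
  rw [condSeqLaw_real_singleton, Real.rpow_sum_of_pos two_pos, ← Finset.prod_mul_distrib]
  refine Finset.prod_congr rfl fun i _ => ?_
  have hcond : 0 < condProb q id f (y i) (f (y i)) := condProb_pos q id f (hy i)
  rw [logRatio, Real.rpow_logb two_pos (by norm_num) (div_pos (hw _ (hy i)) hcond),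
    Function.comp_apply, mul_div_cancel₀ _ hcond.ne']

lemma integral_logRatio [Fintype B] [Fintype C] (f : B → C) (hw : ∀ b, q b ≠ 0 → 0 < w b) :
    ∫ b, logRatio q f w b ∂q.toMeasure
      = ∫ b, Real.logb 2 (w b) ∂q.toMeasure + condEntropy q id f := by
  rw [condEntropy_eq_integral, ← sub_eq_add_neg, ← integral_sub .of_finite .of_finite]
  refine integral_congr_ae ?_
  filter_upwards [ae_apply_ne_zero q] with b hb
  exact Real.logb_div (hw b hb).ne' (condProb_pos q id f hb).ne'

variable [Finite B] {f : B → C} {ε : ℝ} {c : Fin n → C} {T : Finset (Fin n → B)}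

lemma le_sum_prod_weight (hw : ∀ b, q b ≠ 0 → 0 < w b)
    (hT : ∀ y ∈ T, Typical q ε y ∧ f ∘ y = c) :
    (condSeqLaw q f c).real T * 2 ^ (n * (∫ b, logRatio q f w b ∂q.toMeasure
      - ε * ∫ b, |logRatio q f w b| ∂q.toMeasure)) ≤ ∑ y ∈ T, ∏ i, w (y i) := by
  rw [← sum_measureReal_singleton, Finset.sum_mul]
  refine Finset.sum_le_sum fun y hy => ?_
  obtain ⟨htyp, rfl⟩ := hT y hy
  rw [prod_weight_eq f hw htyp.apply_ne_zero]
  have := (abs_le.1 (htyp.abs_sum_sub_le (logRatio q f w))).1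
  gcongr
  · exact one_le_two
  · linarith

lemma sum_prod_weight_le (hc : ∀ i, q.map f (c i) ≠ 0) (hw : ∀ b, q b ≠ 0 → 0 < w b)
    (hT : ∀ y ∈ T, Typical q ε y ∧ f ∘ y = c) :
    ∑ y ∈ T, ∏ i, w (y i) ≤ 2 ^ (n * (∫ b, logRatio q f w b ∂q.toMeasure
      + ε * ∫ b, |logRatio q f w b| ∂q.toMeasure)) := by
  have := isProbabilityMeasure_condSeqLaw hc
  refine le_trans (Finset.sum_le_sum fun y hy => ?_) ((Finset.sum_mul ..).symm.trans_le <|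
    (congrArg (· * _) (sum_measureReal_singleton (μ := condSeqLaw q f c) T)).trans_le <|
    mul_le_of_le_one_left (by positivity) measureReal_le_one)
  obtain ⟨htyp, rfl⟩ := hT y hy
  rw [prod_weight_eq f hw htyp.apply_ne_zero]
  have := (abs_le.1 (htyp.abs_sum_sub_le (logRatio q f w))).2
  gcongr
  · exact one_le_two
  · linarith

end LogRatio

lemma tendsto_two_rpow_neg_natCast_mul {η : ℝ} (hη : 0 < η) :
    Tendsto (fun n : ℕ => (2 : ℝ) ^ (-(n * η))) atTop (𝓝 0) := by
  have hpow : ∀ n : ℕ, (2 : ℝ) ^ (-(n * η)) = ((2 : ℝ) ^ (-η)) ^ n := fun n => by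
    rw [← Real.rpow_mul_natCast two_pos.le, neg_mul, mul_comm]
  simp only [hpow]
  exact tendsto_pow_atTop_nhds_zero_of_lt_one (by positivity)
    (Real.rpow_lt_one_of_one_lt_of_neg one_lt_two (neg_lt_zero.2 hη))

section Covering

variable {ι C : Type*} {β : ι → Type*} {n : ℕ}

/-- The product over `s ∈ T` of the kernels `k s`, evaluated at a tuple. -/
def kernelProd (k : ∀ s, C → β s → ℝ) (T : Finset ι) (y : C × ∀ s, β s) : ℝ :=
  ∏ s ∈ T, k s y.1 (y.2 s)

/-- The part of a tuple that is known once its components in `D` are revealed. -/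
def revealed (D : Finset ι) (y : C × ∀ s, β s) : (∀ s : D, β s) × C := (D.restrict y.2, y.1)

/-- The sequence of tuples formed by `c` and the sequences `x s`. -/
def zipSeq (c : Fin n → C) (x : ∀ s, Fin n → β s) (i : Fin n) : C × ∀ s, β s :=
  (c i, fun s => x s i)

lemma zipSeq_injective (c : Fin n → C) : Function.Injective (zipSeq (β := β) c) := fun _ _ h =>
  funext₂ fun s i => congrFun (congrArg Prod.snd (congrFun h i)) s

lemma prod_kernelProd_zipSeq (k : ∀ s, C → β s → ℝ) (T : Finset ι) (c : Fin n → C)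
    (x : ∀ s, Fin n → β s) :
    ∏ i, kernelProd k T (zipSeq c x i) = ∏ s ∈ T, ∏ i, k s (c i) (x s i) :=
  Finset.prod_comm

lemma integral_logb_kernelProd [Finite ι] [∀ s, Finite (β s)] [Finite C]
    [MeasurableSpace C] [DiscreteMeasurableSpace C] [∀ s, MeasurableSpace (β s)]
    [∀ s, DiscreteMeasurableSpace (β s)] {q : PMF (C × ∀ s, β s)} {k : ∀ s, C → β s → ℝ}
    (hk : ∀ y, q y ≠ 0 → ∀ s, 0 < k s y.1 (y.2 s)) (T : Finset ι) :
    ∫ y, Real.logb 2 (kernelProd k T y) ∂q.toMeasure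
      = ∑ s ∈ T, ∫ y, Real.logb 2 (k s y.1 (y.2 s)) ∂q.toMeasure := by
  rw [← integral_finsetSum _ fun s _ => .of_finite]
  refine integral_congr_ae ?_
  filter_upwards [ae_apply_ne_zero q] with y hy
  exact Real.logb_prod _ _ fun s _ => (hk y hy s).ne'

variable [Fintype ι]

section TypicalWords

variable [∀ s, Fintype (β s)]

open Classical in
/-- The tuples of sequences that are jointly typical together with `c`. -/
def typicalWords (q : PMF (C × ∀ s, β s)) (ε : ℝ) (c : Fin n → C) :
    Finset (∀ s, Fin n → β s) := {x | Typical q ε (zipSeq c x)}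

lemma mem_typicalWords {q : PMF (C × ∀ s, β s)} {ε : ℝ} {c : Fin n → C} {x : ∀ s, Fin n → β s} :
    x ∈ typicalWords q ε c ↔ Typical q ε (zipSeq c x) := by
  simp [typicalWords]

variable [Finite C] [MeasurableSpace C] [DiscreteMeasurableSpace C] [∀ s, MeasurableSpace (β s)]
  [∀ s, DiscreteMeasurableSpace (β s)] {q : PMF (C × ∀ s, β s)} {k : ∀ s, C → β s → ℝ}

lemma half_mul_le_sum_prod_kernel (hk : ∀ y, q y ≠ 0 → ∀ s, 0 < k s y.1 (y.2 s)) {ε : ℝ}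
    {c : Fin n → C} (hc : 1 / 2 ≤ (condSeqLaw q Prod.fst c).real {y | Typical q ε y}) :
    1 / 2 * 2 ^ (n * (∫ y, logRatio q Prod.fst (kernelProd k Finset.univ) y ∂q.toMeasure
        - ε * ∫ y, |logRatio q Prod.fst (kernelProd k Finset.univ) y| ∂q.toMeasure))
      ≤ ∑ x ∈ typicalWords q ε c, ∏ s, ∏ i, k s (c i) (x s i) := by
  classical
  have hsupport : {y | Typical q ε y}
      ≤ᵐ[condSeqLaw q Prod.fst c] (((typicalWords q ε c).image (zipSeq c) : Finset _) : Set _) := by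
    filter_upwards [ae_condSeqLaw q Prod.fst c] with y hy htyp
    have hzip : zipSeq c (fun s i => (y i).2 s) = y :=
      funext fun i => Prod.ext (hy i).2.symm rfl
    exact Finset.mem_coe.2 (Finset.mem_image.2
      ⟨_, mem_typicalWords.2 (hzip.symm ▸ htyp), hzip⟩)
  have hprob := hc.trans (ENNReal.toReal_mono (measure_ne_top _ _) (measure_mono_ae hsupport))
  simp only [← prod_kernelProd_zipSeq]
  rw [← Finset.sum_image (f := fun y => ∏ i, kernelProd k Finset.univ (y i))
    (zipSeq_injective c).injOn]
  refine le_trans ?_ (le_sum_prod_weight (q := q) (f := Prod.fst) (ε := ε) (c := c)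
    (fun y hy => Finset.prod_pos fun s _ => hk y hy s) fun y hy => ?_)
  · gcongr
    exact hprob
  · obtain ⟨x, hx, rfl⟩ := Finset.mem_image.1 hy
    exact ⟨mem_typicalWords.1 hx, rfl⟩

open Classical in
lemma sum_prod_kernel_compl_le [DecidableEq ι] (hk : ∀ y, q y ≠ 0 → ∀ s, 0 < k s y.1 (y.2 s))
    {ε : ℝ} {c : Fin n → C} (D : Finset ι) {x : ∀ s, Fin n → β s}
    (hx : x ∈ typicalWords q ε c) :
    ∑ y ∈ typicalWords q ε c with ∀ s ∈ D, y s = x s, ∏ s ∈ Dᶜ, ∏ i, k s (c i) (y s i)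
      ≤ 2 ^ (n * (∫ y, logRatio q (revealed D) (kernelProd k Dᶜ) y ∂q.toMeasure
        + ε * ∫ y, |logRatio q (revealed D) (kernelProd k Dᶜ) y| ∂q.toMeasure)) := by
  simp only [← prod_kernelProd_zipSeq]
  rw [← Finset.sum_image (f := fun y => ∏ i, kernelProd k Dᶜ (y i)) (zipSeq_injective c).injOn]
  refine sum_prod_weight_le (c := revealed D ∘ zipSeq c x)
    (fun i => map_apply_ne_zero q _ ((mem_typicalWords.1 hx).apply_ne_zero i))
    (fun y hy => Finset.prod_pos fun s _ => hk y hy s) fun y hy => ?_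
  obtain ⟨x', hx', rfl⟩ := Finset.mem_image.1 hy
  rw [Finset.mem_filter, mem_typicalWords] at hx'
  refine ⟨hx'.1, funext fun i => Prod.ext (funext fun s => ?_) rfl⟩
  exact congrFun (hx'.2 s s.2) i

end TypicalWords

variable [MeasurableSpace C] [∀ s, MeasurableSpace (β s)]

/-- The fluctuation of the exponents of typical sequences, per unit of `ε`. -/
def slack [DecidableEq ι] (q : PMF (C × ∀ s, β s)) (k : ∀ s, C → β s → ℝ) (D : Finset ι) : ℝ :=
  ∫ y, |logRatio q Prod.fst (kernelProd k Finset.univ) y| ∂q.toMeasure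
    + ∫ y, |logRatio q (revealed D) (kernelProd k Dᶜ) y| ∂q.toMeasure

lemma slack_nonneg [DecidableEq ι] (q : PMF (C × ∀ s, β s)) (k : ∀ s, C → β s → ℝ)
    (D : Finset ι) : 0 ≤ slack q k D := by
  unfold slack
  positivity

variable [∀ s, Fintype (β s)] [Fintype C]

/-- The exponent at which the number of choices of the codewords in `D` exceeds what is needed for
covering: `∑_{s ∈ D} r s` minus the divergence of the law of these components from the product of
the kernels, up to the fluctuation of typical sequences. -/
def coveringExponent [DecidableEq ι] (q : PMF (C × ∀ s, β s)) (k : ∀ s, C → β s → ℝ) (ε : ℝ)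
    (r : ι → ℝ) (D : Finset ι) : ℝ :=
  ∑ s ∈ D, r s + (∑ s ∈ D, ∫ y, Real.logb 2 (k s y.1 (y.2 s)) ∂q.toMeasure
    + condEntropy q (fun y => D.restrict y.2) Prod.fst) - ε * slack q k D

/-- The bound on the probability that a random code of block length `n` fails to cover. -/
def coveringBound [DecidableEq ι] (q : PMF (C × ∀ s, β s)) (k : ∀ s, C → β s → ℝ) (ε : ℝ)
    (r : ι → ℝ) (n : ℕ) : ℝ :=
  ∑ D : Finset ι with D.Nonempty, 2 * 2 ^ (-(n * coveringExponent q k ε r D))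

lemma coveringBound_nonneg [DecidableEq ι] (q : PMF (C × ∀ s, β s)) (k : ∀ s, C → β s → ℝ)
    (ε : ℝ) (r : ι → ℝ) (n : ℕ) : 0 ≤ coveringBound q k ε r n := by
  unfold coveringBound
  positivity

variable {q : PMF (C × ∀ s, β s)} {k : ∀ s, C → β s → ℝ}

lemma tendsto_coveringBound [DecidableEq ι] {ε : ℝ} {r : ι → ℝ}
    (h : ∀ D : Finset ι, D.Nonempty → 0 < coveringExponent q k ε r D) :
    Tendsto (coveringBound q k ε r) atTop (𝓝 0) := by
  have hsum := tendsto_finsetSum (Finset.univ.filter Finset.Nonempty) fun D hD =>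
    (tendsto_two_rpow_neg_natCast_mul (h D (Finset.mem_filter.1 hD).2)).const_mul 2
  simp only [mul_zero, Finset.sum_const_zero] at hsum
  exact hsum

variable [DiscreteMeasurableSpace C] [∀ s, DiscreteMeasurableSpace (β s)]

lemma integral_logRatio_sub_integral_logRatio [DecidableEq ι]
    (hk : ∀ y, q y ≠ 0 → ∀ s, 0 < k s y.1 (y.2 s)) (D : Finset ι) :
    ∫ y, logRatio q Prod.fst (kernelProd k Finset.univ) y ∂q.toMeasure
        - ∫ y, logRatio q (revealed D) (kernelProd k Dᶜ) y ∂q.toMeasure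
      = ∑ s ∈ D, ∫ y, Real.logb 2 (k s y.1 (y.2 s)) ∂q.toMeasure
        + condEntropy q (fun y => D.restrict y.2) Prod.fst := by
  have hpos : ∀ T : Finset ι, ∀ y, q y ≠ 0 → 0 < kernelProd k T y := fun T y hy =>
    Finset.prod_pos fun s _ => hk y hy s
  have hchain : condEntropy q id Prod.fst
      = condEntropy q (fun y => D.restrict y.2) Prod.fst + condEntropy q id (revealed D) :=
    condEntropy_chain_rule q id (fun y => D.restrict y.2) Prod.fst
  rw [integral_logRatio _ (hpos _), integral_logRatio _ (hpos _), integral_logb_kernelProd hk,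
    integral_logb_kernelProd hk, hchain, ← Finset.sum_add_sum_compl D]
  ring

lemma IsRandomCode.measureReal_forall_not_typical_le [DecidableEq ι]
    (hk : ∀ y, q y ≠ 0 → ∀ s, 0 < k s y.1 (y.2 s)) {ε : ℝ} {r : ι → ℝ} {c : Fin n → C}
    (hc : 1 / 2 ≤ (condSeqLaw q Prod.fst c).real {y | Typical q ε y})
    {Ω : Type*} [MeasurableSpace Ω] {ν : Measure Ω} [IsProbabilityMeasure ν]
    {κ : ι → Type*} [∀ s, Fintype (κ s)] (hκ : ∀ s, 2 ^ (n * r s) ≤ (Fintype.card (κ s) : ℝ))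
    {X : ∀ s, κ s → Ω → Fin n → β s}
    (hX : IsRandomCode X (fun s x => ∏ i, k s (c i) (x i)) ν) :
    ν.real {ω | ∀ a, ¬ Typical q ε (zipSeq c (word X a ω))} ≤ coveringBound q k ε r n := by
  have (s : ι) : Nonempty (κ s) := Fintype.card_pos_iff.1
    (Nat.cast_pos.1 ((Real.rpow_pos_of_pos two_pos _).trans_le (hκ s)))
  have hhit := half_mul_le_sum_prod_kernel hk hc
  have hcover := hX.measureReal_forall_notMem_le (typicalWords q ε c)
    (lt_of_lt_of_le (by positivity) hhit)
    (fun D => 2 ^ (n * (∫ y, logRatio q (revealed D) (kernelProd k Dᶜ) y ∂q.toMeasure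
      + ε * ∫ y, |logRatio q (revealed D) (kernelProd k Dᶜ) y| ∂q.toMeasure)))
    fun D _ x hx => by convert sum_prod_kernel_compl_le hk D hx
  simp only [mem_typicalWords] at hcover
  refine hcover.trans (Finset.sum_le_sum fun D _ => ?_)
  have hcard : (2 : ℝ) ^ (n * ∑ s ∈ D, r s) ≤ ∏ s ∈ D, (Fintype.card (κ s) : ℝ) := by
    rw [Finset.mul_sum, Real.rpow_sum_of_pos two_pos]
    exact Finset.prod_le_prod (fun s _ => by positivity) fun s _ => hκ s
  rw [coveringExponent, ← integral_logRatio_sub_integral_logRatio hk, slack]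
  set m₀ := ∫ y, logRatio q Prod.fst (kernelProd k Finset.univ) y ∂q.toMeasure
  set v₀ := ∫ y, |logRatio q Prod.fst (kernelProd k Finset.univ) y| ∂q.toMeasure
  set m₁ := ∫ y, logRatio q (revealed D) (kernelProd k Dᶜ) y ∂q.toMeasure
  set v₁ := ∫ y, |logRatio q (revealed D) (kernelProd k Dᶜ) y| ∂q.toMeasure
  calc
    _ ≤ (2 : ℝ) ^ (n * (m₁ + ε * v₁))
          / (1 / 2 * 2 ^ (n * (m₀ - ε * v₀)) * 2 ^ (n * ∑ s ∈ D, r s)) :=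
        div_le_div_of_nonneg_left (by positivity) (by positivity)
          (mul_le_mul hhit hcard (by positivity) (le_trans (by positivity) hhit))
    _ = 2 * 2 ^ (n * (m₁ + ε * v₁) - (n * (m₀ - ε * v₀) + n * ∑ s ∈ D, r s)) := by
        rw [Real.rpow_sub two_pos, Real.rpow_add two_pos]
        field_simp
    _ = _ := by ring_nf

end Covering

lemma measureReal_inter_le_of_fiber {Ω A : Type*} [MeasurableSpace Ω] [Finite A]
    [MeasurableSpace A] [MeasurableSingletonClass A] (μ : Measure Ω) [IsProbabilityMeasure μ]
    {V : Ω → A} (hV : Measurable V) {B G : Set Ω} {t : ℝ} (ht : 0 ≤ t)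
    (h : ∀ ω ∈ G, μ (V ⁻¹' {V ω}) ≠ 0 → (μ[|V ⁻¹' {V ω}]).real B ≤ t) :
    μ.real (B ∩ G) ≤ t := by
  have := Fintype.ofFinite A
  have hfiber : ∀ v, μ.real (V ⁻¹' {v}) * (μ[|V ⁻¹' {v}]).real (B ∩ G)
      ≤ μ.real (V ⁻¹' {v}) * t := fun v => by
    by_cases h0 : μ (V ⁻¹' {v}) = 0
    · simp [measureReal_def, h0]
    refine mul_le_mul_of_nonneg_left ?_ measureReal_nonneg
    rcases (V ⁻¹' {v} ∩ (B ∩ G)).eq_empty_or_nonempty with hempty | ⟨ω, rfl, -, hG⟩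
    · rwa [measureReal_def, ← cond_inter_self (hV (measurableSet_singleton v)), hempty,
        measure_empty, ENNReal.toReal_zero]
    · exact (measureReal_mono Set.inter_subset_left).trans (h ω hG h0)
  have htotal : ∑ v, μ.real (V ⁻¹' {v}) = 1 := by
    rw [sum_measureReal_preimage_singleton _ fun v _ => hV (measurableSet_singleton v),
      Finset.coe_univ, Set.preimage_univ, probReal_univ]
  rw [← sum_real_fiber_mul_cond_real μ hV]
  refine (Finset.sum_le_sum fun v _ => hfiber v).trans_eq ?_
  rw [← Finset.sum_mul, htotal, one_mul]

section Hierarchy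

variable {K : ℕ} {α : Sets K → Type*} {l : ℕ}

lemma mem_upper {T : Sets K} : T ∈ upper K l ↔ l < T.1.card := by simp [upper]

lemma mem_level {T : Sets K} : T ∈ level K l ↔ T.1.card = l := by simp [level]

lemma above_subset_upper {S : Sets K} (hS : S ∈ level K l) : above S ⊆ upper K l := fun T hT => by
  rw [mem_upper, ← mem_level.1 hS]
  exact Finset.card_lt_card (Finset.mem_filter.1 hT).2

/-- The components of a tuple in the levels above `l` and in level `l`. -/
def levelPair (l : ℕ) (u : ∀ S, α S) : (∀ T : upper K l, α T) × ∀ S : level K l, α S :=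
  ((upper K l).restrict u, (level K l).restrict u)

/-- The conditional pmf by which the codewords of level `l` are generated from those of the levels
above. -/
def levelKernel (p : PMF (∀ S, α S)) (l : ℕ) (S : level K l) (c : ∀ T : upper K l, α T)
    (b : α S) : ℝ :=
  condProb p (fun u => u S.1) (above S.1).restrict b
    (Finset.restrict₂ (above_subset_upper S.2) c)

/-- The inverse of `levelPair`, up to forgetting the levels below `l + 1`. -/
def joinLevel (l : ℕ) (y : (∀ T : upper K (l + 1), α T) × ∀ S : level K (l + 1), α S) :
    ∀ T : upper K l, α T := fun T =>
  if h : T.1 ∈ upper K (l + 1) then y.1 ⟨T.1, h⟩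
  else y.2 ⟨T.1, mem_level.2 (le_antisymm (not_lt.1 (mt mem_upper.2 h)) (mem_upper.1 T.2))⟩

lemma joinLevel_comp_levelPair (l : ℕ) :
    joinLevel l ∘ levelPair (l + 1) = (upper K l).restrict (π := α) := by
  funext u T
  simp only [Function.comp_apply, joinLevel]
  split_ifs <;> rfl

lemma levelKernel_pos (p : PMF (∀ S, α S)) (l : ℕ)
    (y : (∀ T : upper K l, α T) × ∀ S : level K l, α S)
    (hy : p.map (levelPair l) y ≠ 0) (S : level K l) : 0 < levelKernel p l S y.1 (y.2 S) := by
  obtain ⟨u, hu, rfl⟩ := (PMF.mem_support_map_iff _ _ _).1 hy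
  exact condProb_pos p (fun u => u S.1) (above S.1).restrict hu

lemma condEntropy_map_levelPair [∀ S, Fintype (α S)] (p : PMF (∀ S, α S))
    (D : Finset (level K l)) :
    condEntropy (p.map (levelPair l)) (fun y => D.restrict y.2) Prod.fst
      = condEntropy p (D.map (Function.Embedding.subtype _)).restrict (upper K l).restrict := by
  rw [condEntropy_map]
  refine condEntropy_congr p _ fun u v => ?_
  constructor <;> refine fun h => funext fun S => ?_
  · obtain ⟨S, hS⟩ := S
    obtain ⟨T, hT, rfl⟩ := Finset.mem_map.1 hS
    exact congrFun h ⟨T, hT⟩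
  · exact congrFun h ⟨S.1.1, Finset.mem_map_of_mem _ S.2⟩

section Exponent

variable [∀ S, MeasurableSpace (α S)]

/-- The total fluctuation of the exponents of all levels, per unit of `ε`. -/
def totalSlack (p : PMF (∀ S, α S)) : ℝ :=
  ∑ l ∈ Finset.range K, ∑ D : Finset (level K l), slack (p.map (levelPair l)) (levelKernel p l) D

lemma slack_le_totalSlack (p : PMF (∀ S, α S)) (hl : l < K) (D : Finset (level K l)) :
    slack (p.map (levelPair l)) (levelKernel p l) D ≤ totalSlack p :=
  (Finset.single_le_sum (fun D _ => slack_nonneg (p.map (levelPair l)) (levelKernel p l) D)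
    (Finset.mem_univ D)).trans
    (Finset.single_le_sum (f := fun l => ∑ D : Finset (level K l),
      slack (p.map (levelPair l)) (levelKernel p l) D)
      (fun _ _ => Finset.sum_nonneg fun _ _ => slack_nonneg _ _ _) (Finset.mem_range.2 hl))

lemma totalSlack_nonneg (p : PMF (∀ S, α S)) : 0 ≤ totalSlack p :=
  Finset.sum_nonneg fun _ _ => Finset.sum_nonneg fun _ _ => slack_nonneg _ _ _

variable [∀ S, Fintype (α S)] [∀ S, MeasurableSingletonClass (α S)]

lemma integral_logb_levelKernel (p : PMF (∀ S, α S)) (S : level K l) :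
    ∫ y, Real.logb 2 (levelKernel p l S y.1 (y.2 S)) ∂(p.map (levelPair l)).toMeasure
      = -condEntropy p (fun u => u S.1) (above S.1).restrict := by
  rw [integral_map_toMeasure, condEntropy_eq_integral, neg_neg]
  rfl

lemma coveringExponent_pos (p : PMF (∀ S, α S)) (hl : l < K) {ε : ℝ} (hε : 0 < ε)
    {r : Sets K → ℝ}
    (hr : ∀ J ⊆ level K l, J.Nonempty → ∑ S ∈ J, r S >
      (∑ S ∈ J, condEntropy p (fun u => u S) (above S).restrict)
        - condEntropy p J.restrict (upper K l).restrict + ε * (1 + totalSlack p))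
    {D : Finset (level K l)} (hD : D.Nonempty) :
    0 < coveringExponent (p.map (levelPair l)) (levelKernel p l) ε (fun S => r S.1) D := by
  have hrate := hr (D.map (Function.Embedding.subtype _))
    (fun S hS => Finset.property_of_mem_map_subtype D hS) (hD.map)
  have hslack : ε * slack (p.map (levelPair l)) (levelKernel p l) D ≤ ε * totalSlack p :=
    mul_le_mul_of_nonneg_left (slack_le_totalSlack p hl D) hε.le
  have hsum (g : Sets K → ℝ) :
      ∑ S ∈ D.map (Function.Embedding.subtype _), g S = ∑ S ∈ D, g S.1 := Finset.sum_map ..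
  rw [hsum, hsum] at hrate
  simp only [coveringExponent, integral_logb_levelKernel, condEntropy_map_levelPair,
    Finset.sum_neg_distrib]
  linarith

end Exponent

section Codebook

variable {r : Sets K → ℝ} {n : ℕ} {Ω : Type*}

lemma rpow_le_numWords (r : Sets K → ℝ) (n : ℕ) {S : Sets K} (hS : S.1.card < K) :
    (2 : ℝ) ^ (n * r S) ≤ numWords r n S := by
  have hne : S.1 ≠ Finset.univ := fun h => by simp [h] at hS
  rw [numWords, if_neg hne, Nat.cast_pow, Nat.cast_ofNat, ← Real.rpow_natCast]
  exact Real.rpow_le_rpow_of_exponent_le one_le_two (Nat.le_ceil _)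

instance nonempty_index : Nonempty (Index r n) :=
  ⟨fun S => ⟨0, by unfold numWords; split_ifs <;> positivity⟩⟩

/-- The sequence of tuples formed by the codewords of the levels above `l` with indices `m`. -/
def upperSeq (U : ∀ S : Sets K, Index r n → Ω → Fin n → α S) (l : ℕ) (m : Index r n) (ω : Ω)
    (i : Fin n) : ∀ T : upper K l, α T :=
  (upper K l).restrict fun T => U T m ω i

/-- All codewords of the levels above `l`. -/
def upperCode (U : ∀ S : Sets K, Index r n → Ω → Fin n → α S) (l : ℕ) (ω : Ω)
    (T : upper K l) (m : Index r n) : Fin n → α T :=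
  U T m ω

/-- The codewords of level `l` that belong to the choice `m` of the indices of the levels above. -/
def levelCode (U : ∀ S : Sets K, Index r n → Ω → Fin n → α S) (l : ℕ) (m : Index r n)
    (S : level K l) (a : Fin (numWords r n S.1)) : Ω → Fin n → α S :=
  U S.1 (Function.update m S.1 a)

/-- The index tuple `m` with the indices of level `l` replaced by `a`. -/
def updateLevel (m : Index r n) (a : ∀ S : level K l, Fin (numWords r n S.1)) : Index r n :=
  fun T => if hT : T ∈ level K l then a ⟨T, hT⟩ else m T

/-- The event that no choice of the indices makes the codewords of the levels above `l` jointly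
typical. -/
def uncovered (p : PMF (∀ S, α S)) (U : ∀ S : Sets K, Index r n → Ω → Fin n → α S) (l : ℕ)
    (ε : ℝ) : Set Ω :=
  {ω | ∀ m, ¬ Typical (p.map (upper K l).restrict) ε (upperSeq U l m ω)}

lemma fiber_upperCode (U : ∀ S : Sets K, Index r n → Ω → Fin n → α S) (l : ℕ) (ω : Ω) :
    upperCode U l ⁻¹' {upperCode U l ω} = sameAbove U l ω := by
  ext ω'
  exact ⟨fun h T hT m => congrFun (congrFun h ⟨T, mem_upper.2 hT⟩) m,
    fun h => funext₂ fun T m => h T.1 (mem_upper.1 T.2) m⟩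

lemma setOf_forall_not_typical_subset_uncovered [∀ S, Finite (α S)] (p : PMF (∀ S, α S))
    (U : ∀ S : Sets K, Index r n → Ω → Fin n → α S) (ε : ℝ) :
    {ω | ∀ m, ¬ Typical p ε fun i S => U S m ω i} ⊆ uncovered p U 0 ε := fun ω hω m hm => by
  have hT := hm.map fun u S => u ⟨S, mem_upper.2 S.2.card_pos⟩
  rw [PMF.map_comp] at hT
  exact hω m (p.map_id ▸ hT)

variable [NeZero K]

lemma ne_whole {S : Sets K} (hS : S.1.card < K) : S ≠ whole K := by
  rintro rfl
  simp [whole] at hS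

lemma eq_whole_of_mem_upper {T : Sets K} (hT : T ∈ upper K (K - 1)) : T = whole K := by
  have hle : T.1.card ≤ K := by simpa using Finset.card_le_univ T.1
  have hlt := mem_upper.1 hT
  refine Subtype.ext (Finset.eq_univ_of_card _ ?_)
  rw [Fintype.card_fin]
  omega

lemma exists_restrict_upper_top_eq_comp (α : Sets K → Type*) :
    ∃ F : α (whole K) → ∀ T : upper K (K - 1), α T,
      (upper K (K - 1)).restrict = F ∘ fun u => u (whole K) := by
  refine ⟨fun x T => (eq_whole_of_mem_upper T.2).symm ▸ x, ?_⟩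
  funext u ⟨T, hT⟩
  obtain rfl := eq_whole_of_mem_upper hT
  rfl

namespace IsCodebook

variable [∀ S, MeasurableSpace (α S)] [MeasurableSpace Ω] {p : PMF (∀ S, α S)} {μ : Measure Ω}
  {UK : Ω → Fin n → α (whole K)} {U : ∀ S : Sets K, Index r n → Ω → Fin n → α S}

lemma measurable_upperCode (h : IsCodebook p r μ UK U) (l : ℕ) : Measurable (upperCode U l) :=
  measurable_pi_iff.2 fun T => measurable_pi_iff.2 fun m => h.measurable T m

lemma update_eq_of_card_lt (h : IsCodebook p r μ UK U) (m : Index r n) {S T : Sets K}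
    (a : Fin (numWords r n S)) (hT : S.1.card < T.1.card) :
    U T (Function.update m S a) = U T m := by
  have hne {T : Sets K} (hT : S.1.card < T.1.card) : T ≠ S := fun h => hT.ne' (h ▸ rfl)
  exact h.index _ _ _ (Function.update_of_ne (hne hT) _ _)
    fun T' hT' => Function.update_of_ne (hne (hT.trans hT')) _ _

lemma updateLevel_eq_of_mem_upper (h : IsCodebook p r μ UK U) (m : Index r n)
    (a : ∀ S : level K l, Fin (numWords r n S.1)) {T : Sets K} (hT : T ∈ upper K l) :
    U T (updateLevel m a) = U T m := by
  have hup {T : Sets K} (hT : l < T.1.card) : updateLevel m a T = m T :=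
    dif_neg fun hT' => hT.ne' (mem_level.1 hT')
  have hlT := mem_upper.1 hT
  exact h.index T _ _ (hup hlT) fun T' hT' => hup (hlT.trans hT')

lemma updateLevel_eq_levelCode (h : IsCodebook p r μ UK U) (m : Index r n)
    (a : ∀ S : level K l, Fin (numWords r n S.1)) (S : level K l) :
    U S.1 (updateLevel m a) = levelCode U l m S (a S) := by
  refine h.index S.1 _ _ (by simp [updateLevel, S.2]) fun T hT => ?_
  have hST : T ≠ S.1 := fun h => hT.ne' (h ▸ rfl)
  rw [Function.update_of_ne hST]
  exact dif_neg fun hT' => hT.ne ((mem_level.1 S.2).trans (mem_level.1 hT').symm)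

lemma upperSeq_updateLevel (h : IsCodebook p r μ UK U) {ω ω' : Ω} (hω' : ω' ∈ sameAbove U (l + 1) ω)
    (m : Index r n) (a : ∀ S : level K (l + 1), Fin (numWords r n S.1)) :
    upperSeq U l (updateLevel m a) ω'
      = joinLevel l ∘ zipSeq (upperSeq U (l + 1) m ω) (word (levelCode U (l + 1) m) a ω') := by
  funext i T
  simp only [Function.comp_apply, joinLevel]
  split_ifs with hT
  · exact congrFun ((congrFun (h.updateLevel_eq_of_mem_upper m a hT) ω').trans
      (hω' T (mem_upper.1 hT) m)) i
  · exact congrFun (congrFun (h.updateLevel_eq_levelCode m a ⟨T, _⟩) ω') i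

lemma upperSeq_top (h : IsCodebook p r μ UK U) (m : Index r n) (ω : Ω)
    {F : α (whole K) → ∀ T : upper K (K - 1), α T}
    (hF : (upper K (K - 1)).restrict = F ∘ fun u => u (whole K)) :
    upperSeq U (K - 1) m ω = F ∘ UK ω := by
  rw [← h.top m]
  exact funext fun i => congrFun hF fun S => U S m ω i

lemma isRandomCode_levelCode (h : IsCodebook p r μ UK U) (hl : 1 ≤ l) (hlK : l < K) {m : Index r n}
    {ω : Ω} (hm : ∀ i, p.map (upper K l).restrict (upperSeq U l m ω i) ≠ 0)
    (h0 : μ (sameAbove U l ω) ≠ 0) :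
    IsRandomCode (levelCode U l m)
      (fun S x => ∏ i, levelKernel p l S (upperSeq U l m ω i) (x i)) (μ[|sameAbove U l ω]) where
  measurable S a := h.measurable _ _
  law S a x := by
    have hS := mem_level.1 S.2
    have hlaw := h.law S.1 (ne_whole (hS.trans_lt hlK)) (Function.update m S.1 a) ω (by rwa [hS])
    have hU (T : above S.1) : U T.1 (Function.update m S.1 a) = U T.1 m :=
      h.update_eq_of_card_lt m a (hS.trans_lt (mem_upper.1 (above_subset_upper S.2 T.2)))
    simp only [hU, hS] at hlaw
    refine hlaw (fun i => ?_) x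
    have hi := map_apply_ne_zero _ (Finset.restrict₂ (π := α) (above_subset_upper S.2)) (hm i)
    rwa [PMF.map_comp] at hi
  pairwise S a b hab := by
    have hS := mem_level.1 S.2
    have hpair := h.pairwise S.1 (ne_whole (hS.trans_lt hlK)) m ω (by rwa [hS]) a b hab
    rwa [hS] at hpair
  iIndep := h.mutual_indep l hl hlK m ω h0

lemma sameAbove_inter_uncovered_subset [∀ S, Finite (α S)] (h : IsCodebook p r μ UK U)
    (m : Index r n) (ω : Ω) (ε : ℝ) :
    sameAbove U (l + 1) ω ∩ uncovered p U l ε ⊆ {ω' | ∀ a, ¬ Typical (p.map (levelPair (l + 1))) ε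
      (zipSeq (upperSeq U (l + 1) m ω) (word (levelCode U (l + 1) m) a ω'))} := by
  rintro ω' ⟨hω', hun⟩ a hT
  refine hun (updateLevel m a) ?_
  rw [h.upperSeq_updateLevel hω', ← joinLevel_comp_levelPair, ← PMF.map_comp]
  exact hT.map (joinLevel l)

variable [∀ S, MeasurableSingletonClass (α S)] [IsProbabilityMeasure μ]

lemma measureReal_uncovered_top_le [∀ S, Finite (α S)] (h : IsCodebook p r μ UK U) (ε : ℝ) :
    μ.real (uncovered p U (K - 1) ε)
      ≤ 1 - μ.real {ω | Typical (p.map fun u => u (whole K)) ε (UK ω)} := by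
  obtain ⟨m₀⟩ : Nonempty (Index r n) := inferInstance
  have hUK : Measurable UK := h.top m₀ ▸ h.measurable (whole K) m₀
  have htyp : MeasurableSet {ω | Typical (p.map fun u => u (whole K)) ε (UK ω)} :=
    Typical.measurableSet_setOf _ ε hUK
  rw [← probReal_compl_eq_one_sub htyp]
  obtain ⟨F, hF⟩ := exists_restrict_upper_top_eq_comp α
  refine measureReal_mono fun ω hω hT => hω m₀ ?_
  rw [h.upperSeq_top m₀ ω hF, hF, ← PMF.map_comp]
  exact hT.map F

variable [∀ S, Fintype (α S)]

lemma cond_real_uncovered_le (h : IsCodebook p r μ UK U) (hl : l + 1 < K) {ε ε' : ℝ}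
    (hc : ∀ c, Typical ((p.map (levelPair (l + 1))).map Prod.fst) ε' c →
      1 / 2 ≤ (condSeqLaw (p.map (levelPair (l + 1))) Prod.fst c).real
        {y : Fin n → _ | Typical (p.map (levelPair (l + 1))) ε y})
    {ω : Ω} (hω : ω ∉ uncovered p U (l + 1) ε') (h0 : μ (sameAbove U (l + 1) ω) ≠ 0) :
    (μ[|sameAbove U (l + 1) ω]).real (uncovered p U l ε)
      ≤ coveringBound (p.map (levelPair (l + 1))) (levelKernel p (l + 1)) ε (fun S => r S.1) n := by
  obtain ⟨m, hm⟩ := not_forall_not.1 hω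
  have := cond_isProbabilityMeasure h0
  have hcode := h.isRandomCode_levelCode l.succ_pos hl hm.apply_ne_zero h0
  have hatom : MeasurableSet (sameAbove U (l + 1) ω) :=
    fiber_upperCode U (l + 1) ω ▸ h.measurable_upperCode (l + 1) (measurableSet_singleton _)
  rw [measureReal_def, ← cond_inter_self hatom]
  refine (measureReal_mono (h.sameAbove_inter_uncovered_subset m ω ε)).trans
    (hcode.measureReal_forall_not_typical_le (levelKernel_pos p (l + 1)) (hc _ ?_) fun S => ?_)
  · rwa [PMF.map_comp]
  · rw [Fintype.card_fin]
    exact rpow_le_numWords r n ((mem_level.1 S.2).trans_lt hl)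

lemma measureReal_uncovered_le (h : IsCodebook p r μ UK U) (hl : l + 1 < K) {ε ε' : ℝ}
    (hc : ∀ c, Typical ((p.map (levelPair (l + 1))).map Prod.fst) ε' c →
      1 / 2 ≤ (condSeqLaw (p.map (levelPair (l + 1))) Prod.fst c).real
        {y : Fin n → _ | Typical (p.map (levelPair (l + 1))) ε y}) :
    μ.real (uncovered p U l ε) ≤ μ.real (uncovered p U (l + 1) ε')
      + coveringBound (p.map (levelPair (l + 1))) (levelKernel p (l + 1)) ε (fun S => r S.1) n := by
  have hnew := measureReal_inter_le_of_fiber μ (h.measurable_upperCode (l + 1))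
    (B := uncovered p U l ε) (G := (uncovered p U (l + 1) ε')ᶜ) (coveringBound_nonneg _ _ _ _ _)
    fun ω hω h0 => by
      rw [fiber_upperCode] at h0 ⊢
      exact h.cond_real_uncovered_le hl hc hω h0
  calc
    _ ≤ μ.real (uncovered p U (l + 1) ε' ∪ (uncovered p U l ε ∩ (uncovered p U (l + 1) ε')ᶜ)) :=
        measureReal_mono fun ω hω => (em _).imp_right fun hω' => ⟨hω, hω'⟩
    _ ≤ _ := (measureReal_union_le _ _).trans (by gcongr)

end IsCodebook

end Codebook

end Hierarchy

lemma tendsto_mul_totalSlack {K : ℕ} {α : Sets K → Type*} [∀ S, MeasurableSpace (α S)]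
    (p : PMF (∀ S, α S)) :
    Tendsto (fun e : ℝ => e * (1 + totalSlack p)) (𝓝[>] 0) (𝓝 0) := by
  have h : Tendsto (fun e : ℝ => e * (1 + totalSlack p)) (𝓝 0) (𝓝 (0 * (1 + totalSlack p))) :=
    tendsto_id.mul_const _
  rw [zero_mul] at h
  exact h.mono_left nhdsWithin_le_nhds

section Asymptotics

variable {K : ℕ} [NeZero K] {α : Sets K → Type*} [∀ S, MeasurableSpace (α S)]
  [∀ S, MeasurableSingletonClass (α S)] {p : PMF (∀ S, α S)}
  {r : Sets K → ℝ} {Ω : ℕ → Type*} [∀ n, MeasurableSpace (Ω n)] {μ : ∀ n, Measure (Ω n)}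
  [∀ n, IsProbabilityMeasure (μ n)] {UK : ∀ n, Ω n → Fin n → α (whole K)}
  {U : ∀ n, ∀ S : Sets K, Index r n → Ω n → Fin n → α S} {ε ε' : ℝ} {l : ℕ}

lemma tendsto_uncovered_top [∀ S, Finite (α S)] (hU : ∀ n, IsCodebook p r (μ n) (UK n) (U n))
    (hUK : Tendsto (fun n => (μ n).real {ω | Typical (p.map fun u => u (whole K)) ε (UK n ω)})
      atTop (𝓝 1)) :
    Tendsto (fun n => (μ n).real (uncovered p (U n) (K - 1) ε)) atTop (𝓝 0) :=
  squeeze_zero (fun _ => measureReal_nonneg) (fun n => (hU n).measureReal_uncovered_top_le ε)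
    (sub_self (1 : ℝ) ▸ hUK.const_sub 1)

lemma tendsto_uncovered_of_succ [∀ S, Fintype (α S)]
    (hU : ∀ n, IsCodebook p r (μ n) (UK n) (U n)) (hl : l + 1 < K)
    (hε : 0 < ε) (hεε' : ε' < ε)
    (hr : ∀ J ⊆ level K (l + 1), J.Nonempty → ∑ S ∈ J, r S >
      (∑ S ∈ J, condEntropy p (fun u => u S) (above S).restrict)
        - condEntropy p J.restrict (upper K (l + 1)).restrict + ε * (1 + totalSlack p))
    (hsucc : Tendsto (fun n => (μ n).real (uncovered p (U n) (l + 1) ε')) atTop (𝓝 0)) :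
    Tendsto (fun n => (μ n).real (uncovered p (U n) l ε)) atTop (𝓝 0) := by
  have hbound := tendsto_coveringBound fun _ => coveringExponent_pos p hl hε hr
  refine squeeze_zero' (.of_forall fun _ => measureReal_nonneg) ?_
    (add_zero (0 : ℝ) ▸ hsucc.add hbound)
  filter_upwards [eventually_half_le_condSeqLaw_typical (p.map (levelPair (l + 1))) Prod.fst hεε']
    with n hn using (hU n).measureReal_uncovered_le hl hn

end Asymptotics

end HierCov

end

theorem lemma1 {K : ℕ} [NeZero K] {α : HierCov.Sets K → Type*}
    [∀ S, Fintype (α S)] [∀ S, MeasurableSpace (α S)] [∀ S, MeasurableSingletonClass (α S)]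
    (p : PMF (∀ S, α S)) :
    ∃ δ : ℝ → ℝ, (∀ e, 0 < e → 0 < δ e) ∧ Tendsto δ (𝓝[>] 0) (𝓝 0) ∧
      ∀ (ε : ℕ → ℝ), 0 < ε K → StrictAntiOn ε (Set.Icc 1 K) →
      ∀ (r : HierCov.Sets K → ℝ)
        (Ω : ℕ → Type*) [∀ n, MeasurableSpace (Ω n)]
        (μ : ∀ n, Measure (Ω n)) [∀ n, IsProbabilityMeasure (μ n)]
        (UK : ∀ n, Ω n → Fin n → α (HierCov.whole K))
        (U : ∀ n, ∀ S : HierCov.Sets K, HierCov.Index r n → Ω n → Fin n → α S),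
      (∀ n, HierCov.IsCodebook p r (μ n) (UK n) (U n)) →
      Tendsto (fun n => (μ n).real
        {ω | HierCov.Typical (p.map fun u => u (HierCov.whole K)) (ε K) (UK n ω)})
        atTop (𝓝 1) →
      (∀ l, 1 ≤ l → l < K → ∀ J ⊆ HierCov.level K l, J.Nonempty →
        ∑ S ∈ J, r S >
          (∑ S ∈ J, HierCov.condEntropy p (fun u => u S) (HierCov.above S).restrict)
            - HierCov.condEntropy p J.restrict (HierCov.upper K l).restrict + δ (ε l)) →
      Tendsto (fun n => (μ n).real
        {ω | ∀ m : HierCov.Index r n,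
          ¬ HierCov.Typical p (ε 1) (fun i S => U n S m ω i)})
        atTop (𝓝 0) := by
  refine ⟨fun e => e * (1 + HierCov.totalSlack p),
    fun e he => mul_pos he (add_pos_of_pos_of_nonneg one_pos (HierCov.totalSlack_nonneg p)),
    HierCov.tendsto_mul_totalSlack p, ?_⟩
  intro ε hεK hanti r Ω _ μ _ UK U hU hUK hr
  have hK : 1 ≤ K := NeZero.one_le
  have htop : Tendsto (fun n => (μ n).real (HierCov.uncovered p (U n) (K - 1) (ε (K - 1 + 1))))
      atTop (𝓝 0) := by
    rw [Nat.sub_add_cancel hK]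
    exact HierCov.tendsto_uncovered_top hU hUK
  have hbottom : Tendsto (fun n => (μ n).real (HierCov.uncovered p (U n) 0 (ε 1))) atTop (𝓝 0) := by
    refine Nat.decreasingInduction' (P := fun l => Tendsto (fun n =>
      (μ n).real (HierCov.uncovered p (U n) l (ε (l + 1)))) atTop (𝓝 0)) ?_ (K - 1).zero_le htop
    intro l hlK _ hsucc
    have hl : l + 1 < K := Nat.add_lt_of_lt_sub hlK
    have hmem : l + 1 ∈ Set.Icc 1 K := ⟨l.succ_pos, hl.le⟩
    exact HierCov.tendsto_uncovered_of_succ hU hl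
      (hεK.trans (hanti hmem ⟨hK, le_rfl⟩ hl))
      (hanti hmem ⟨(l + 1).succ_pos, hl⟩ (l + 1).lt_succ_self)
      (hr (l + 1) l.succ_pos hl) hsucc
  exact squeeze_zero (fun _ => measureReal_nonneg) (fun n => measureReal_mono
    (HierCov.setOf_forall_not_typical_subset_uncovered p (U n) (ε 1))) hbottom
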